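/- **Setting (rotating-wave spin-boson model).** A two-level atom with orthonormal basis $|g\rangle,|e\rangle$ is coupled to bosonic modes labelled by $\lambda\in\Lambda$, where $(\Lambda,\mu)$ is a measure space (counting measure for discrete modes; below, $\sum_\lambda$ means $\int d\mu(\lambda)$), with frequencies $\omega_\lambda\in\mathbb R$ and couplings $g_\lambda\in\mathbb C$, $\sum_\lambda|g_\lambda|^2<\infty$. In the frame rotating with the free Hamiltonian (atomic frequency $\omega_0\in\mathbb R$, $\hbar>0$) the Hamiltonian on $\mathbb C^2\otimes\mathcal F$, with $\mathcal F$ the bosonic Fock space over $L^2(\mu)$, is $$H(t)=\tilde B(t)^\dagger\sigma+\sigma^\dagger\tilde B(t),\qquad \sigma=|g\rangle\langle e|,\qquad \tilde B(t)=\sum_\lambda e^{-i(\omega_\lambda-\omega_0)t}\,\hbar g_\lambda b_\lambda .$$ Let $U(t|s)$ be the evolution generated by $H$ from time $s$ to time $t$ (the time-ordered exponential), let $|\psi(t)\rangle=U(t|0)(|e\rangle\otimes|\mathrm{vac}\rangle)$, and let $q(t)=(\langle e|\otimes\langle\mathrm{vac}|)\,|\psi(t)\rangle$. Let $$f(u)=\hbar^{-2}\langle\mathrm{vac}|\tilde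 B(u)\tilde B(0)^\dagger|\mathrm{vac}\rangle$$ be the bath correlation function and $J=\sum_\lambda|g_\lambda|^2\delta_{\omega_\lambda}$ the spectral density, a finite positive measure on $\mathbb R$. Let $A,B,C$ be copies of the atom: just before an intervention at time $t$, just after it, and at time $t+\tau$. The process matrix $W(t,\tau)$ on $A\otimes B\otimes C$, computed in this rotating frame, is given by $W(t,\tau)^{\mathrm T}=\mathrm{Tr}_{\rm Env}|\kappa\rangle\langle\kappa|$ with the unnormalized vector $$|\kappa\rangle=U(t+\tau|t)_{C\,\rm Env}\Big(|\psi(t)\rangle_{A\,\rm Env}\otimes\sum_{i\in\{g,e\}}|i\rangle_B\otimes|i\rangle_C\Big)$$ (transposition with respect to the basis $|g\rangle,|e\rangle$). An operator $\Theta$ on $A\otimes B\otimes C$ is an entanglement retriever, $\Theta\in\mathbf{ER}$, if $\Theta\succcurlyeq0$ and $\eta\otimes\mathrm{id}_C\succcurlyeq\mathrm{Tr}_A\Theta$ for some density operator $\eta$ on $B$. An operator $W$ has classical memory, $W\in\mathbf{CM}$, if $W=\int\varrho_\lambda\otimes N_\lambda\,d\omega_\lambda$ for a probability measure $\omega$,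 density operators $\varrho_\lambda$ on $A$ and operators $N_\lambda\succcurlyeq0$ on $B\otimes C$ with $\mathrm{Tr}_CN_\lambda=\mathrm{id}_B$; otherwise it has quantum memory. Let $$\Theta_*=2\,|g\rangle\langle g|_B\otimes|\Psi^-\rangle\langle\Psi^-|_{AC},\qquad |\Psi^-\rangle=\tfrac1{\sqrt2}\big(|g\rangle\otimes|e\rangle-|e\rangle\otimes|g\rangle\big).$$ **Statement.** For all such modes, frequencies and couplings (hence for every spectral density): 1. $\Theta_*\in\mathbf{ER}$. 2. $f(u)=\int e^{i(\omega_0-\omega)u}\,dJ(\omega)$ for all $u\in\mathbb R$. 3. $q(0)=1$ and $q'(t)=-\int_0^t f(t-s)\,q(s)\,ds$ for all $t\ge0$ (one-sided derivative at $t=0$), and $q$ is the only function on $[0,\infty)$ with these properties. 4. For all $t,\tau\ge0$, $$\mathrm{Tr}[\Theta_*W(t,\tau)]=\left|q(t)+\int_0^t\!\int_0^\tau f(t+\tau-r-s)\,q(r)\,q(s)\,ds\,dr\right|^2 .$$ 5. If $t,\tau\ge0$ and $\mathrm{Tr}[\Theta_*W(t,\tau)]>1$, then $W(t,\tau)\notin\mathbf{CM}$: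 the process has quantum memory. -/

import Mathlib

open scoped Kronecker ComplexConjugate InnerProductSpace ComplexOrder
open MeasureTheory

noncomputable section

/-! Process matrices, entanglement retrievers and classical memory. Operators on
`A ⊗ B ⊗ C` are matrices indexed by `A × (B × C)`, in fixed orthonormal bases. -/

section ProcessMatrices

variable {A B C : Type*} [Fintype A] [Fintype B] [Fintype C]

/-- Density operator: positive semidefinite with unit trace. -/
def IsDensity (ρ : Matrix A A ℂ) : Prop :=
  ρ.PosSemidef ∧ ρ.trace = 1

/-- Partial trace over the first factor. -/
def traceLeft (X : Matrix (A × B) (A × B) ℂ) : Matrix B B ℂ :=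
  fun x y => ∑ a, X (a, x) (a, y)

/-- Partial trace over the second factor. -/
def traceRight (X : Matrix (A × B) (A × B) ℂ) : Matrix A A ℂ :=
  fun x y => ∑ b, X (x, b) (y, b)

/-- Entanglement retriever: `Θ ≽ 0` and `η ⊗ id_C ≽ Tr_A Θ` for some density operator `η`
on `B`. -/
def IsEntanglementRetriever [DecidableEq C]
    (Θ : Matrix (A × (B × C)) (A × (B × C)) ℂ) : Prop :=
  Θ.PosSemidef ∧
    ∃ η : Matrix B B ℂ, IsDensity η ∧ (η ⊗ₖ (1 : Matrix C C ℂ) - traceLeft Θ).PosSemidef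

/-- Choi matrix of a quantum channel from `B` to `C`: `N ≽ 0` and `Tr_C N = id_B`. -/
def IsChannelChoi [DecidableEq B] (N : Matrix (B × C) (B × C) ℂ) : Prop :=
  N.PosSemidef ∧ traceRight N = 1

/-- Classical memory: `W = ∫ ρ_l ⊗ N_l dP(l)` for a probability measure `P`, density
operators `ρ_l` on `A` and Choi matrices `N_l` of channels from `B` to `C`. A process matrix
exhibits quantum memory when this fails. -/
def HasClassicalMemory [DecidableEq B] (W : Matrix (A × (B × C)) (A × (B × C)) ℂ) : Prop :=
  ∃ (L : Type) (_ : MeasurableSpace L) (P : Measure L) (_ : IsProbabilityMeasure P)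
    (ρ : L → Matrix A A ℂ) (N : L → Matrix (B × C) (B × C) ℂ),
    (∀ i j, Measurable fun l => ρ l i j) ∧ (∀ i j, Measurable fun l => N l i j) ∧
    (∀ l, IsDensity (ρ l)) ∧ (∀ l, IsChannelChoi (N l)) ∧
    ∀ i j, W i j = ∫ l, (ρ l ⊗ₖ N l) i j ∂P

end ProcessMatrices

/-- The two levels of the atom: ground and excited. -/
inductive Level : Type
  | g
  | e
  deriving DecidableEq

instance : Fintype Level where
  elems := {Level.g, Level.e}
  complete := by rintro (_ | _) <;> simp

/-- The singlet `|Ψ⁻⟩ = (|g⟩ ⊗ |e⟩ - |e⟩ ⊗ |g⟩) / √2`. -/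
def singlet : Level → Level → ℂ
  | .g, .e => ((Real.sqrt 2)⁻¹ : ℝ)
  | .e, .g => -((Real.sqrt 2)⁻¹ : ℝ)
  | _, _ => 0

/-- `Θ_* = 2 |g⟩⟨g| ⊗ |Ψ⁻⟩⟨Ψ⁻|`, where `|g⟩` is in `B` and `|Ψ⁻⟩` in `A ⊗ C`. -/
def singletRetriever :
    Matrix (Level × (Level × Level)) (Level × (Level × Level)) ℂ :=
  fun x y => 2 * (if x.2.1 = Level.g ∧ y.2.1 = Level.g then 1 else 0) *
    (singlet x.1 x.2.2 * conj (singlet y.1 y.2.2))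

/-! The bosonic environment. -/

/-- Bosonic Fock space over a one-particle space with orthonormal basis indexed by `ι`, in the
occupation-number representation: `|n⟩`, for finitely supported `n : ι →₀ ℕ`, is the standard
orthonormal basis of `ℓ²(ι →₀ ℕ)`. -/
abbrev FockSpace (ι : Type*) : Type _ := lp (fun _ : ι →₀ ℕ => ℂ) 2

/-- The vacuum. -/
def vacuum (ι : Type*) : FockSpace ι := by
  classical exact lp.single 2 (0 : ι →₀ ℕ) 1

/-- The Hilbert space `ℂ² ⊗ Env`; the component `ψ s` is `(⟨s| ⊗ id) ψ`. -/
abbrev TotalSpace (ι : Type*) : Type _ := PiLp 2 (fun _ : Level => FockSpace ι)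

/-- The product vector `|s⟩ ⊗ χ`. -/
def ketTensor {ι : Type*} (s : Level) (χ : FockSpace ι) : TotalSpace ι :=
  WithLp.toLp 2 (fun s' => if s' = s then χ else 0)

/-- The spin-boson model with rotating-wave coupling. The bosonic modes are labelled by a
measure space `(Λ, μ)`, with frequencies `freq` and square-integrable couplings `coupling`:
the sum over the modes is the integral over `μ`, so counting measure gives discrete modes and
a continuum of modes is allowed as well. `basis` is an orthonormal basis of the one-particle
space `L²(μ)` in which the Fock space is written. -/
structure SpinBoson (Λ ι : Type*) [MeasurableSpace Λ] where
  μ : Measure Λ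
  freq : Λ → ℝ
  measurable_freq : Measurable freq
  coupling : Λ → ℂ
  memLp_coupling : MemLp coupling 2 μ
  basis : HilbertBasis ι ℂ (Lp ℂ 2 μ)
  hbar : ℝ
  hbar_pos : 0 < hbar
  omega0 : ℝ

namespace SpinBoson

variable {Λ ι : Type*} [MeasurableSpace Λ] (M : SpinBoson Λ ι)

open Classical in
/-- Annihilation operator `b(v) = ∫ conj (v l) b_l dμ(l) = ∑ i, ⟨v, e_i⟩ b_i`, where
`b_i |n⟩ = √(n_i) |n - δ_i⟩`, on its natural domain (the value off the domain is `0`). -/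
def annihilate (v : Lp ℂ 2 M.μ) (χ : FockSpace ι) : FockSpace ι :=
  if h : Memℓp (E := fun _ : ι →₀ ℕ => ℂ) (fun n : ι →₀ ℕ => ∑' i, ⟪v, M.basis i⟫_ℂ *
      ((Real.sqrt ((n i : ℝ) + 1) : ℝ) : ℂ) * χ (n + Finsupp.single i 1)) 2
  then ⟨_, h⟩ else 0

open Classical in
/-- Creation operator `b(v)† = ∑ i, ⟨e_i, v⟩ b_i†`, where `b_i† |n⟩ = √(n_i + 1) |n + δ_i⟩`,
on its natural domain (the value off the domain is `0`). -/
def create (v : Lp ℂ 2 M.μ) (χ : FockSpace ι) : FockSpace ι :=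
  if h : Memℓp (E := fun _ : ι →₀ ℕ => ℂ) (fun n : ι →₀ ℕ => ∑ i ∈ n.support,
      ⟪M.basis i, v⟫_ℂ * ((Real.sqrt (n i : ℝ) : ℝ) : ℂ) * χ (n - Finsupp.single i 1)) 2
  then ⟨_, h⟩ else 0

/-- The function `l ↦ conj (g l) * exp (i (ω_l - ω₀) t)`. -/
def modeFun (t : ℝ) (l : Λ) : ℂ :=
  conj (M.coupling l) * Complex.exp (Complex.I * ((M.freq l - M.omega0) * t : ℝ))

lemma memLp_modeFun (t : ℝ) : MemLp (M.modeFun t) 2 M.μ := by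
  refine M.memLp_coupling.of_le ?_ (Filter.Eventually.of_forall fun l => ?_)
  · refine (Complex.continuous_conj.comp_aestronglyMeasurable
      M.memLp_coupling.aestronglyMeasurable).mul ?_
    have := M.measurable_freq
    exact (by fun_prop : Measurable fun l =>
      Complex.exp (Complex.I * ((M.freq l - M.omega0) * t : ℝ))).aestronglyMeasurable
  · rw [modeFun, norm_mul, mul_comm Complex.I, Complex.norm_exp_ofReal_mul_I]
    simp

/-- `modeFun` as a vector of the one-particle space. -/
def modeVec (t : ℝ) : Lp ℂ 2 M.μ := (M.memLp_modeFun t).toLp (M.modeFun t)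

/-- `B̃(t) = ∑_l exp (-i (ω_l - ω₀) t) ħ g_l b_l`. -/
def bathOp (t : ℝ) (χ : FockSpace ι) : FockSpace ι :=
  (M.hbar : ℂ) • M.annihilate (M.modeVec t) χ

/-- The adjoint `B̃(t)†`. -/
def bathOpAdj (t : ℝ) (χ : FockSpace ι) : FockSpace ι :=
  (M.hbar : ℂ) • M.create (M.modeVec t) χ

/-- The Hamiltonian `B̃(t)† σ + σ† B̃(t)`, with `σ = |g⟩⟨e|`, in the frame rotating with the
free Hamiltonian. -/
def hamiltonian (t : ℝ) (ψ : TotalSpace ι) : TotalSpace ι :=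
  ketTensor Level.g (M.bathOpAdj t (ψ Level.e)) + ketTensor Level.e (M.bathOp t (ψ Level.g))

/-- The terms of the time-ordered exponential applied to `ψ`:
`D₀(t) = ψ` and `D_{n+1}(t) = (iħ)⁻¹ ∫_s^t H(r) D_n(r) dr`. -/
def dysonTerm (s : ℝ) (ψ : TotalSpace ι) : ℕ → ℝ → TotalSpace ι
  | 0 => fun _ => ψ
  | n + 1 => fun t =>
      (Complex.I * M.hbar)⁻¹ • ∫ r in s..t, M.hamiltonian r (dysonTerm s ψ n r)

/-- `U(t|s) ψ`: the time-ordered exponential of the Hamiltonian from time `s` to time `t`.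
It is applied below to vectors with at most two excitations only; the number of excitations is
conserved and the Hamiltonian is bounded on vectors with boundedly many excitations, so the
series converges in norm to the solution of the Schrödinger equation. -/
def evolve (t s : ℝ) (ψ : TotalSpace ι) : TotalSpace ι :=
  ∑' n, M.dysonTerm s ψ n t

/-- The state `|ψ(t)⟩` evolved from `|e⟩ ⊗ |vac⟩` at time `0`. -/
def state (t : ℝ) : TotalSpace ι :=
  M.evolve t 0 (ketTensor Level.e (vacuum ι))

/-- The probability amplitude `q(t)` of the initial state at time `t`. -/
def amplitude (t : ℝ) : ℂ :=
  ⟪ketTensor Level.e (vacuum ι), M.state t⟫_ℂ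

/-- The bath correlation function `f(u) = ħ⁻² ⟨vac| B̃(u) B̃(0)† |vac⟩`, which is
`ħ⁻² exp (i ω₀ u) ⟨vac| B(u) B† |vac⟩` for the bath operator `B(u)` evolved freely. -/
def bathCorrelation (u : ℝ) : ℂ :=
  ((M.hbar : ℂ) ^ 2)⁻¹ * ⟪vacuum ι, M.bathOp u (M.bathOpAdj 0 (vacuum ι))⟫_ℂ

/-- The spectral density `J(ω) dω = ∑_l |g_l|² δ(ω - ω_l) dω`, as a measure on `ℝ`. -/
def spectralDensity : Measure ℝ :=
  (M.μ.withDensity fun l => ‖M.coupling l‖ₑ ^ 2).map M.freq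

/-- The environment components `(⟨a| ⊗ ⟨b| ⊗ ⟨c| ⊗ id) κ` of the unnormalized vector
`κ = U(t+τ|t)_{C Env} (|ψ(t)⟩_{A Env} ⊗ ∑ i, |i⟩_B ⊗ |i⟩_C)`. -/
def kappa (t τ : ℝ) (x : Level × (Level × Level)) : FockSpace ι :=
  M.evolve (t + τ) t (ketTensor x.2.1 (M.state t x.1)) x.2.2

/-- The process matrix `W(t,τ)` of the two-point measurement scenario:
`Wᵀ = Tr_Env {[ρ_{A Env}(t)^Γ ⊗ id_{BC}] (id_A ⊗ J)}`, where `Γ` is the partial transpose on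
the environment and `J` the Choi matrix of the evolution from `t` to `t + τ` with the final
environment traced out. For the pure state `ρ_{A Env}(t) = |ψ(t)⟩⟨ψ(t)|` the right-hand side
is `Tr_Env |κ⟩⟨κ|`, with entries `Tr |κ_x⟩⟨κ_y| = ⟨κ_y, κ_x⟩`. -/
def processMatrix (t τ : ℝ) :
    Matrix (Level × (Level × Level)) (Level × (Level × Level)) ℂ :=
  Matrix.transpose fun x y => ⟪M.kappa t τ y, M.kappa t τ x⟫_ℂ

end SpinBoson

/-- `q` solves `q'(t) = -∫₀ᵗ f(t - s) q(s) ds` for `t ≥ 0`, with `q(0) = 1` (the derivative at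
`t = 0` is one-sided). -/
def SolvesMemoryEquation (f q : ℝ → ℂ) : Prop :=
  q 0 = 1 ∧
    ∀ t, 0 ≤ t → HasDerivWithinAt q (-∫ s in (0 : ℝ)..t, f (t - s) * q s) (Set.Ici 0) t

end

/-! Classical memory is bounded by a trace estimate. For a density operator `ρ` and a channel `N`,
`ρ ≤ 1` gives `Tr Θ(ρ ⊗ N) ≤ Tr Θ(1 ⊗ N) = Tr (Tr_A Θ) N ≤ Tr (η ⊗ 1) N = Tr η = 1`, and integrating
over the mixture keeps the bound. The singlet has marginal `1/2`, so `Θ_*` is a retriever with `η =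
|g⟩⟨g|`.

The Hamiltonian conserves the number of excitations, and only components of `κ` with at most one
excitation enter `Tr Θ_* W`. The one-excitation sector is `ℂ × L²(μ)`: an atomic amplitude `z` and a
boson `w`, with `z' = -i⟨v(t), w⟩`, `w' = -i z v(t)` and `⟨v t, v s⟩ = f (t - s)`. Integrating out
`w` gives the memory equation. Conversely, a solution of the memory equation together with its
integral for `w` solves the sector equation, whose solution is unique.

If the atom is found in `e` at time `t` and replaced by `g`, nothing evolves and the amplitude is `q
t`. If it is found in `g`, the emitted boson may be reabsorbed. Unitarity gives this amplitude: the
inner product with the solution that ends excited and without bosons at `t + τ` is constant, and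
that solution is the time reversal of `q`. The result is minus the double integral, and the sign of
the singlet turns the difference into a sum. The carriers are
`IsEntanglementRetriever.re_trace_mul_kronecker_le_one`, `SolvesExchange.fst_add_eq` and
`hamiltonian_sector`. -/

noncomputable section

/-! ### Entanglement retrievers bound classical memory -/

section ClassicalMemory

variable {A B C : Type*} [Fintype A] [Fintype B] [Fintype C]

lemma exists_eq_conjTranspose_mul_self {X : Matrix A A ℂ} (hX : X.PosSemidef) :
    ∃ Y : Matrix A A ℂ, X = Y.conjTranspose * Y := by
  classical
  open scoped MatrixOrder in
  exact CStarAlgebra.nonneg_iff_eq_star_mul_self.mp hX.nonneg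

lemma trace_mul_nonneg_of_posSemidef {X Y : Matrix A A ℂ} (hX : X.PosSemidef)
    (hY : Y.PosSemidef) : 0 ≤ (X * Y).trace := by
  obtain ⟨Z, rfl⟩ := exists_eq_conjTranspose_mul_self hX
  rw [Matrix.mul_assoc, Matrix.trace_mul_comm]
  exact (hY.mul_mul_conjTranspose_same Z).trace_nonneg

/-- With `X = Y* Y`, the arithmetic-geometric inequality bounds the entry by the mean of two
diagonal entries. This makes the integrands of a classical memory bounded. -/
lemma norm_apply_le_trace_of_posSemidef {X : Matrix A A ℂ} (hX : X.PosSemidef) (i j : A) :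
    ‖X i j‖ ≤ X.trace.re := by
  obtain ⟨Y, rfl⟩ := exists_eq_conjTranspose_mul_self hX
  have hd : ∀ i, ((Y.conjTranspose * Y) i i).re = ∑ k, ‖Y k i‖ ^ 2 := fun i => by
    simp only [Matrix.mul_apply, Matrix.conjTranspose_apply, Complex.re_sum]
    refine Finset.sum_congr rfl fun k _ => ?_
    rw [Complex.star_def, ← Complex.normSq_eq_conj_mul_self, Complex.ofReal_re,
      Complex.normSq_eq_norm_sq]
  have ht : ∀ i, ∑ k, ‖Y k i‖ ^ 2 ≤ (Y.conjTranspose * Y).trace.re := fun i => by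
    rw [Matrix.trace, Complex.re_sum]
    simp only [Matrix.diag_apply, hd]
    exact Finset.single_le_sum (f := fun i => ∑ k, ‖Y k i‖ ^ 2)
      (fun _ _ => by positivity) (Finset.mem_univ i)
  calc ‖(Y.conjTranspose * Y) i j‖ ≤ ∑ k, ‖Y k i‖ * ‖Y k j‖ := by
        rw [Matrix.mul_apply]
        refine (norm_sum_le _ _).trans (le_of_eq ?_)
        simp
    _ ≤ ∑ k, (‖Y k i‖ ^ 2 + ‖Y k j‖ ^ 2) / 2 :=
        Finset.sum_le_sum fun k _ => by nlinarith [sq_nonneg (‖Y k i‖ - ‖Y k j‖)]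
    _ ≤ _ := by
        rw [← Finset.sum_div, Finset.sum_add_distrib]
        linarith [ht i, ht j]

/-- The eigenvalues are nonnegative and sum to `1`, so none exceeds `1`; diagonalize. -/
lemma IsDensity.one_sub_posSemidef [DecidableEq A] {ρ : Matrix A A ℂ} (hρ : IsDensity ρ) :
    (1 - ρ).PosSemidef := by
  have hH := hρ.1.isHermitian
  have h1 : ∀ i, hH.eigenvalues i ≤ 1 := fun i => by
    have h := hH.trace_eq_sum_eigenvalues
    rw [hρ.2] at h
    have h' : ∑ i, hH.eigenvalues i = 1 := by simpa using congrArg Complex.re h.symm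
    rw [← h']
    exact Finset.single_le_sum (f := hH.eigenvalues)
      (fun j _ => hρ.1.eigenvalues_nonneg j) (Finset.mem_univ i)
  have hD : (Matrix.diagonal fun i => (1 - hH.eigenvalues i : ℂ)).PosSemidef :=
    Matrix.PosSemidef.diagonal fun i => by
      have := h1 i
      simp only [Pi.zero_apply]
      exact_mod_cast sub_nonneg.2 this
  have hU := hD.mul_mul_conjTranspose_same (hH.eigenvectorUnitary : Matrix A A ℂ)
  convert hU using 1
  have hd : (Matrix.diagonal fun i => (1 - hH.eigenvalues i : ℂ)) =
      1 - Matrix.diagonal fun i => (hH.eigenvalues i : ℂ) := by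
    rw [← Matrix.diagonal_one, Matrix.diagonal_sub]
  have hUU : (hH.eigenvectorUnitary : Matrix A A ℂ) *
      (hH.eigenvectorUnitary : Matrix A A ℂ).conjTranspose = 1 :=
    Unitary.mul_star_self_of_mem hH.eigenvectorUnitary.2
  rw [hd, Matrix.mul_sub, Matrix.sub_mul, Matrix.mul_one, hUU]
  congr 1
  exact hH.spectral_theorem

lemma IsEntanglementRetriever.re_trace_mul_kronecker_le_one [DecidableEq A] [DecidableEq B]
    [DecidableEq C]
    {Θ : Matrix (A × (B × C)) (A × (B × C)) ℂ} (hΘ : IsEntanglementRetriever Θ)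
    {ρ : Matrix A A ℂ} (hρ : IsDensity ρ) {N : Matrix (B × C) (B × C) ℂ}
    (hN : IsChannelChoi N) : (Θ * (ρ ⊗ₖ N)).trace.re ≤ 1 := by
  obtain ⟨hΘ0, η, hη, hΘη⟩ := hΘ
  -- The two inequalities of the chain: `h1` replaces `ρ` by `1`, and `h2` replaces `Tr_A Θ` by `η ⊗
  -- 1`.
  have h1 : 0 ≤ (Θ * ((1 - ρ) ⊗ₖ N)).trace :=
    trace_mul_nonneg_of_posSemidef hΘ0 (hρ.one_sub_posSemidef.kronecker hN.1)
  have h2 := trace_mul_nonneg_of_posSemidef hΘη hN.1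
  have h3 : (Θ * ((1 : Matrix A A ℂ) ⊗ₖ N)).trace = (traceLeft Θ * N).trace := by
    simp only [Matrix.trace, Matrix.diag_apply, Matrix.mul_apply, traceLeft,
      Matrix.kroneckerMap_apply, Fintype.sum_prod_type (α₁ := A), Matrix.one_apply,
      ite_mul, one_mul, zero_mul, mul_ite, mul_zero, Finset.sum_ite_irrel, Finset.sum_const_zero,
      Finset.sum_ite_eq', Finset.mem_univ, if_true, Finset.sum_mul]
    rw [Finset.sum_comm]
    exact Finset.sum_congr rfl fun _ _ => Finset.sum_comm
  have h4 : ((η ⊗ₖ (1 : Matrix C C ℂ)) * N).trace = (η * traceRight N).trace := by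
    simp only [Matrix.trace, Matrix.diag_apply, Matrix.mul_apply, traceRight,
      Matrix.kroneckerMap_apply, Fintype.sum_prod_type, Matrix.one_apply,
      ite_mul, zero_mul, mul_ite, mul_one, mul_zero, Finset.sum_ite_eq,
      Finset.mem_univ, if_true, Finset.mul_sum]
    exact Finset.sum_congr rfl fun _ _ => Finset.sum_comm
  have h5 : (Θ * ((1 - ρ) ⊗ₖ N)).trace =
      (Θ * ((1 : Matrix A A ℂ) ⊗ₖ N)).trace - (Θ * (ρ ⊗ₖ N)).trace := by
    rw [← Matrix.trace_sub, ← Matrix.mul_sub]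
    congr 2
    ext i j
    simp [Matrix.kroneckerMap_apply, sub_mul]
  rw [Matrix.sub_mul, Matrix.trace_sub, h4, hN.2, mul_one, hη.2] at h2
  rw [h5, h3] at h1
  have h1' := (Complex.le_def.1 h1).1
  have h2' := (Complex.le_def.1 h2).1
  simp only [Complex.zero_re, Complex.sub_re, Complex.one_re] at h1' h2'
  linarith

theorem IsEntanglementRetriever.re_trace_mul_le_one_of_hasClassicalMemory [DecidableEq A]
    [DecidableEq B] [DecidableEq C]
    {Θ : Matrix (A × (B × C)) (A × (B × C)) ℂ} (hΘ : IsEntanglementRetriever Θ)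
    {W : Matrix (A × (B × C)) (A × (B × C)) ℂ} (hW : HasClassicalMemory W) :
    (Θ * W).trace.re ≤ 1 := by
  obtain ⟨L, _, P, _, ρ, N, hρm, hNm, hρ, hN, hWρN⟩ := hW
  have hint : ∀ i j, Integrable (fun l => (ρ l ⊗ₖ N l) i j) P := fun i j => by
    -- An entry of `ρ l` is at most its trace `1`, and an entry of `N l` at most its trace, the
    -- dimension of `B`.
    refine Integrable.of_bound (C := 1 * Fintype.card B)
      ((hρm _ _).mul (hNm _ _)).aestronglyMeasurable (Filter.Eventually.of_forall fun l => ?_)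
    rw [Matrix.kroneckerMap_apply, norm_mul]
    refine mul_le_mul ?_ ?_ (norm_nonneg _) zero_le_one
    · simpa [(hρ l).2] using norm_apply_le_trace_of_posSemidef (hρ l).1 i.1 j.1
    · have h : (N l).trace = Fintype.card B := by
        rw [← Matrix.trace_one (n := B), ← (hN l).2]
        simp [Matrix.trace, traceRight, Fintype.sum_prod_type]
      simpa [h] using norm_apply_le_trace_of_posSemidef (hN l).1 i.2 j.2
  have htr : (Θ * W).trace = ∫ l, (Θ * (ρ l ⊗ₖ N l)).trace ∂P := by
    simp only [Matrix.trace, Matrix.diag_apply, Matrix.mul_apply, hWρN]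
    refine ((integral_finsetSum _ fun i _ => integrable_finsetSum _ fun j _ =>
      (hint j i).const_mul _).trans (Finset.sum_congr rfl fun i _ => ?_)).symm
    exact (integral_finsetSum _ fun j _ => (hint j i).const_mul _).trans
      (Finset.sum_congr rfl fun j _ => integral_const_mul _ _)
  have hI : Integrable (fun l => (Θ * (ρ l ⊗ₖ N l)).trace) P := by
    simp only [Matrix.trace, Matrix.diag_apply, Matrix.mul_apply]
    exact integrable_finsetSum _ fun i _ => integrable_finsetSum _ fun j _ =>
      (hint j i).const_mul _
  have hre : (Θ * W).trace.re = ∫ l, (Θ * (ρ l ⊗ₖ N l)).trace.re ∂P := by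
    rw [htr]; exact (integral_re hI).symm
  rw [hre]
  calc _ ≤ ∫ _, (1 : ℝ) ∂P := integral_mono hI.re (integrable_const _)
        fun l => hΘ.re_trace_mul_kronecker_le_one (hρ l) (hN l)
    _ = 1 := by simp

end ClassicalMemory

/-! ### The singlet retriever -/

lemma two_mul_inv_sqrt_two_mul_self :
    2 * ((((Real.sqrt 2)⁻¹ : ℝ) : ℂ) * (((Real.sqrt 2)⁻¹ : ℝ) : ℂ)) = 1 := by
  rw [← Complex.ofReal_mul, ← mul_inv, Real.mul_self_sqrt (by norm_num)]
  push_cast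
  norm_num

lemma sum_level {V : Type*} [AddCommMonoid V] (f : Level → V) : ∑ s, f s = f .g + f .e := by
  change ∑ s ∈ ({Level.g, Level.e} : Finset Level), f s = _
  rw [Finset.sum_pair (by decide)]

/-- The vector `|g⟩_B ⊗ |Ψ⁻⟩_{AC}`. -/
def singletVec (x : Level × (Level × Level)) : ℂ :=
  if x.2.1 = Level.g then singlet x.1 x.2.2 else 0

lemma singletRetriever_apply (x y : Level × (Level × Level)) :
    singletRetriever x y = 2 * (singletVec x * conj (singletVec y)) := by
  rw [singletRetriever, singletVec, singletVec]
  by_cases hx : x.2.1 = Level.g <;> by_cases hy : y.2.1 = Level.g <;> simp [hx, hy]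

theorem isEntanglementRetriever_singletRetriever :
    IsEntanglementRetriever singletRetriever := by
  refine ⟨?_, Matrix.diagonal (fun s => if s = Level.g then 1 else 0), ⟨?_, ?_⟩, ?_⟩
  · have h : singletRetriever = (2 : ℂ) • Matrix.vecMulVec singletVec (star singletVec) := by
      ext x y
      simp [singletRetriever_apply, Matrix.vecMulVec_apply]
    rw [h]
    exact (Matrix.posSemidef_vecMulVec_self_star _).smul (by norm_num)
  · exact Matrix.PosSemidef.diagonal fun s => by dsimp only; split_ifs <;> simp
  · simp [Matrix.trace_diagonal]
  -- The factor `2` cancels the singlet marginal `1/2`, so the inequality is an equality for `η =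
  -- |g⟩⟨g|`.
  · convert Matrix.PosSemidef.zero using 1
    rw [sub_eq_zero]
    ext ⟨b, c⟩ ⟨b', c'⟩
    have h2 := two_mul_inv_sqrt_two_mul_self
    rcases b with _ | _ <;> rcases c with _ | _ <;> rcases b' with _ | _ <;>
      rcases c' with _ | _ <;>
      simp only [Matrix.kroneckerMap_apply, traceLeft, sum_level, singletRetriever, singlet,
        Matrix.diagonal_apply, Matrix.one_apply] <;> simp <;> simpa using h2.symm

/-! ### Dyson series of a bounded linear equation -/

section Dyson

variable {𝕜 E : Type*} [NontriviallyNormedField 𝕜] [NormedAddCommGroup E] [NormedSpace 𝕜 E]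
  [NormedSpace ℝ E]

/-- Iterated integrals of the Dyson series of the linear equation `x' = A x`, `x s = x₀`. -/
def dysonIterate (A : ℝ → E →L[𝕜] E) (s : ℝ) (x₀ : E) : ℕ → ℝ → E
  | 0 => fun _ => x₀
  | n + 1 => fun t => ∫ r in s..t, A r (dysonIterate A s x₀ n r)

variable {A : ℝ → E →L[𝕜] E} {s : ℝ} {x₀ : E}

lemma continuous_dysonIterate (hA : Continuous A) (n : ℕ) :
    Continuous (dysonIterate A s x₀ n) := by
  induction n with
  | zero => exact continuous_const
  | succ n ih =>
    exact intervalIntegral.continuous_primitive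
      (fun a b => (hA.clm_apply ih).intervalIntegrable a b) s

/-- Each integration of `|r - s| ^ n` contributes a factor `1 / (n + 1)`, hence the factorial.
Absolute values allow `t` on either side of `s`. -/
lemma norm_dysonIterate_le {C : ℝ} (hC : ∀ t, ‖A t‖ ≤ C) (n : ℕ) (t : ℝ) :
    ‖dysonIterate A s x₀ n t‖ ≤ (C * |t - s|) ^ n / n.factorial * ‖x₀‖ := by
  have hC0 : 0 ≤ C := (norm_nonneg _).trans (hC 0)
  induction n generalizing t with
  | zero => simp [dysonIterate]
  | succ n ih =>
    have h1 : ‖dysonIterate A s x₀ (n + 1) t‖ ≤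
        |∫ r in s..t, C * ((C * |r - s|) ^ n / n.factorial * ‖x₀‖)| := by
      refine intervalIntegral.norm_integral_le_abs_of_norm_le
        (Filter.Eventually.of_forall fun r => ?_) ?_
      · exact ((A r).le_opNorm _).trans (mul_le_mul (hC r) (ih r) (norm_nonneg _) hC0)
      · exact Continuous.intervalIntegrable (by fun_prop) _ _
    refine h1.trans (le_of_eq ?_)
    have h2 : ∀ r : ℝ, C * ((C * |r - s|) ^ n / n.factorial * ‖x₀‖) =
        (C ^ (n + 1) / n.factorial * ‖x₀‖) * |r - s| ^ n := fun r => by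
      rw [mul_pow]; ring
    have h3 : |∫ r in s..t, |r - s| ^ n| = |t - s| ^ (n + 1) / (n + 1) := by
      rcases le_total s t with h | h
      · have : ∫ r in s..t, |r - s| ^ n = ∫ r in s..t, (r - s) ^ n :=
          intervalIntegral.integral_congr fun r hr => by
            rw [Set.uIcc_of_le h] at hr
            simp only [abs_of_nonneg (sub_nonneg.2 hr.1)]
        rw [this, intervalIntegral.integral_comp_sub_right (fun r => r ^ n), sub_self,
          integral_pow, abs_of_nonneg (sub_nonneg.2 h), abs_of_nonneg]
        · simp
        · have := sub_nonneg.2 h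
          simp only [ne_eq, Nat.add_eq_zero_iff, one_ne_zero, and_false, not_false_eq_true,
            zero_pow, sub_zero]
          positivity
      · have : ∫ r in s..t, |r - s| ^ n = ∫ r in s..t, (s - r) ^ n :=
          intervalIntegral.integral_congr fun r hr => by
            rw [Set.uIcc_of_ge h] at hr
            simp only [abs_of_nonpos (sub_nonpos.2 hr.2), neg_sub]
        rw [this, intervalIntegral.integral_comp_sub_left (fun r => r ^ n), sub_self,
          integral_pow, abs_sub_comm t s, abs_of_nonneg (sub_nonneg.2 h),
          zero_pow n.succ_ne_zero, zero_sub, neg_div, abs_neg, abs_of_nonneg]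
        have := sub_nonneg.2 h
        positivity
    simp_rw [h2]
    rw [intervalIntegral.integral_const_mul, abs_mul, h3, abs_of_nonneg (by positivity),
      Nat.factorial_succ, mul_pow]
    push_cast
    field_simp

/-- The Dyson series. -/
def dysonSum (A : ℝ → E →L[𝕜] E) (s : ℝ) (x₀ : E) (t : ℝ) : E := ∑' n, dysonIterate A s x₀ n t

lemma dysonSum_self : dysonSum A s x₀ s = x₀ := by
  rw [dysonSum, tsum_eq_single 0]
  · rfl
  · rintro (_ | n) h
    · exact absurd rfl h
    · exact intervalIntegral.integral_same

variable [CompleteSpace E]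

lemma summable_dysonIterate {C : ℝ} (hC : ∀ t, ‖A t‖ ≤ C) (t : ℝ) :
    Summable fun n => dysonIterate A s x₀ n t :=
  Summable.of_norm_bounded ((Real.summable_pow_div_factorial _).mul_right _)
    fun n => norm_dysonIterate_le hC n t

lemma hasDerivAt_dysonSum {C : ℝ} (hA : Continuous A) (hC : ∀ t, ‖A t‖ ≤ C) (t : ℝ) :
    HasDerivAt (dysonSum A s x₀) (A t (dysonSum A s x₀ t)) t := by
  have hC0 : 0 ≤ C := (norm_nonneg _).trans (hC 0)
  -- `R` bounds `|r - s|` on the unit ball around `t`, where the series is differentiated termwise.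
  -- The derivatives `D` are the terms shifted by one and hit by `A`, with `0` in front.
  let R : ℝ := |t - s| + 1
  let u : ℕ → ℝ := fun n => C * ((C * R) ^ n / n.factorial * ‖x₀‖)
  have hu : Summable u := ((Real.summable_pow_div_factorial _).mul_right _).mul_left _
  let D : ℕ → ℝ → E := fun n => match n with
    | 0 => fun _ => 0
    | n + 1 => fun r => A r (dysonIterate A s x₀ n r)
  have hD : ∀ n r, HasDerivAt (dysonIterate A s x₀ n) (D n r) r := by
    rintro (_ | n) r
    · exact hasDerivAt_const _ _
    · have hc := hA.clm_apply (continuous_dysonIterate (s := s) (x₀ := x₀) hA n)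
      exact intervalIntegral.integral_hasDerivAt_right (hc.intervalIntegrable _ _)
        (hc.stronglyMeasurableAtFilter _ _) hc.continuousAt
  let v : ℕ → ℝ := fun n => match n with
    | 0 => 0
    | n + 1 => u n
  have hv : Summable v := (summable_nat_add_iff 1).1 hu
  have hb : ∀ n, ∀ r ∈ Metric.ball t 1, ‖D n r‖ ≤ v n := by
    rintro (_ | n) r hr
    · simp [D, v]
    · have hr' : |r - s| ≤ R := by
        rw [Metric.mem_ball, Real.dist_eq] at hr
        have := abs_sub_le r t s
        simp only [R]; linarith
      refine ((A r).le_opNorm _).trans (mul_le_mul (hC r)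
        ((norm_dysonIterate_le hC n r).trans ?_) (norm_nonneg _) hC0)
      gcongr
  have key := hasDerivAt_tsum_of_isPreconnected hv Metric.isOpen_ball
    (convex_ball t 1).isPreconnected (fun n r _ => hD n r) hb (Metric.mem_ball_self one_pos)
    (summable_dysonIterate hC t) (Metric.mem_ball_self one_pos)
  refine key.congr_deriv ?_
  rw [(Summable.of_norm_bounded hv fun n => hb n t (Metric.mem_ball_self one_pos)).tsum_eq_zero_add]
  simp only [D, zero_add]
  exact ((A t).map_tsum (summable_dysonIterate hC t)).symm

end Dyson

/-! ### The one-excitation equation and its memory kernel -/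

section SingleExcitation

variable {H : Type*} [NormedAddCommGroup H] [InnerProductSpace ℂ H]

/-- Generator `(z, w) ↦ -i (⟨v, w⟩, z v)` of the excitation exchange between the atom and the
one-particle vector `v`. -/
def exchangeGenerator (v : H) : ℂ × H →L[ℂ] ℂ × H :=
  (-Complex.I) • ((ContinuousLinearMap.inl ℂ ℂ H).comp
      ((innerSL ℂ v).comp (ContinuousLinearMap.snd ℂ ℂ H)) +
    (ContinuousLinearMap.inr ℂ ℂ H).comp ((ContinuousLinearMap.fst ℂ ℂ H).smulRight v))

@[simp]
lemma exchangeGenerator_apply (v : H) (x : ℂ × H) :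
    exchangeGenerator v x = (-Complex.I * ⟪v, x.2⟫_ℂ, -Complex.I • x.1 • v) := by
  ext <;> simp [exchangeGenerator]

/-- The product carries the sup norm, and the generator swaps the components, each at the cost of a
factor `‖v‖`. -/
lemma norm_exchangeGenerator_le (v : H) : ‖exchangeGenerator v‖ ≤ ‖v‖ := by
  refine ContinuousLinearMap.opNorm_le_bound _ (norm_nonneg _) fun x => ?_
  rw [exchangeGenerator_apply, Prod.norm_def]
  refine max_le ?_ ?_
  · simp only [norm_mul, norm_neg, Complex.norm_I, one_mul]
    exact (norm_inner_le_norm _ _).trans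
      (mul_le_mul_of_nonneg_left (norm_snd_le x) (norm_nonneg _))
  · simp only [norm_smul, norm_neg, Complex.norm_I, one_mul]
    rw [mul_comm]
    exact mul_le_mul_of_nonneg_left (norm_fst_le x) (norm_nonneg _)

lemma continuous_exchangeGenerator : Continuous (exchangeGenerator : H → _) := by
  have h1 : Continuous fun v : H => innerSL ℂ v := (innerSL ℂ).continuous
  have h2 : Continuous fun v : H => (ContinuousLinearMap.fst ℂ ℂ H).smulRight v :=
    (ContinuousLinearMap.smulRightL ℂ (ℂ × H) H (ContinuousLinearMap.fst ℂ ℂ H)).continuous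
  unfold exchangeGenerator
  fun_prop

/-- `x` solves the single-excitation Schrödinger equation with coupling vectors `v`. -/
def SolvesExchange (v : ℝ → H) (x : ℝ → ℂ × H) : Prop :=
  ∀ t, HasDerivAt x (exchangeGenerator (v t) (x t)) t

namespace SolvesExchange

variable {v : ℝ → H} {x y : ℝ → ℂ × H}

lemma hasDerivAt_fst (hx : SolvesExchange v x) (t : ℝ) :
    HasDerivAt (fun t => (x t).1) (-Complex.I * ⟪v t, (x t).2⟫_ℂ) t := by
  have := (ContinuousLinearMap.fst ℝ ℂ H).hasFDerivAt.comp_hasDerivAt t (hx t)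
  simpa [Function.comp_def] using this

lemma hasDerivAt_snd (hx : SolvesExchange v x) (t : ℝ) :
    HasDerivAt (fun t => (x t).2) (-Complex.I • (x t).1 • v t) t := by
  have := (ContinuousLinearMap.snd ℝ ℂ H).hasFDerivAt.comp_hasDerivAt t (hx t)
  simpa [Function.comp_def] using this

lemma continuous_fst (hx : SolvesExchange v x) : Continuous fun t => (x t).1 :=
  continuous_iff_continuousAt.2 fun t => (hx.hasDerivAt_fst t).continuousAt

lemma snd_eq [CompleteSpace H] (hv : Continuous v) (hx : SolvesExchange v x) {s : ℝ}
    (hs : (x s).2 = 0) (t : ℝ) :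
    (x t).2 = -Complex.I • ∫ r in s..t, (x r).1 • v r := by
  have h := intervalIntegral.integral_eq_sub_of_hasDerivAt (a := s) (b := t)
    (fun r _ => hx.hasDerivAt_snd r)
    (((hx.continuous_fst.smul hv).const_smul (-Complex.I)).intervalIntegrable _ _)
  rw [hs, sub_zero] at h
  rw [← h, intervalIntegral.integral_smul]

/-- The evolution is unitary: the inner product of two solutions is constant. -/
lemma inner_const (hx : SolvesExchange v x) (hy : SolvesExchange v y) (s t : ℝ) :
    conj (y s).1 * (x s).1 + ⟪(y s).2, (x s).2⟫_ℂ =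
      conj (y t).1 * (x t).1 + ⟪(y t).2, (x t).2⟫_ℂ := by
  have h : ∀ u, HasDerivAt
      (fun u => conj (y u).1 * (x u).1 + ⟪(y u).2, (x u).2⟫_ℂ) 0 u := fun u => by
    have h1 : HasDerivAt (fun u => conj (y u).1) (conj (-Complex.I * ⟪v u, (y u).2⟫_ℂ)) u :=
      (hy.hasDerivAt_fst u).star
    refine ((h1.mul (hx.hasDerivAt_fst u)).add
      ((hy.hasDerivAt_snd u).inner ℂ (hx.hasDerivAt_snd u))).congr_deriv ?_
    -- The generator is skew-adjoint, so the four terms cancel in pairs.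
    simp only [inner_smul_left, inner_smul_right, map_mul, map_neg, Complex.conj_I,
      inner_conj_symm]
    ring
  exact is_const_of_deriv_eq_zero (fun u => (h u).differentiableAt) (fun u => (h u).deriv) s t

end SolvesExchange

lemma inner_integral_smul [CompleteSpace H] {v : ℝ → H} (hv : Continuous v) {q : ℝ → ℂ} (w : H)
    {a b : ℝ} (hq : ContinuousOn q (Set.uIcc a b)) :
    ⟪w, ∫ r in a..b, q r • v r⟫_ℂ = ∫ r in a..b, ⟪w, v r⟫_ℂ * q r := by
  have h := (innerSL ℂ w).intervalIntegral_comp_comm (μ := volume)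
    (hq.smul hv.continuousOn).intervalIntegrable
  simp only [innerSL_apply_apply] at h
  refine h.symm.trans (intervalIntegral.integral_congr fun r _ => ?_)
  simp [inner_smul_right, mul_comm]

variable {v : ℝ → H} {f : ℝ → ℂ}

lemma conj_correlation (hf : ∀ t s, ⟪v t, v s⟫_ℂ = f (t - s)) (u : ℝ) : conj (f u) = f (-u) := by
  have h1 := hf u 0
  have h2 := hf 0 u
  rw [sub_zero] at h1
  rw [zero_sub] at h2
  rw [← h1, ← h2, inner_conj_symm]

lemma conj_intervalIntegral (g : ℝ → ℂ) (a b : ℝ) :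
    conj (∫ r in a..b, g r) = ∫ r in a..b, conj (g r) := by
  simp only [intervalIntegral, map_sub, integral_conj]

variable [CompleteSpace H]

lemma SolvesExchange.hasDerivAt_memory (hv : Continuous v) (hf : ∀ t s, ⟪v t, v s⟫_ℂ = f (t - s))
    {x : ℝ → ℂ × H} (hx : SolvesExchange v x) (h0 : (x 0).2 = 0) (t : ℝ) :
    HasDerivAt (fun t => (x t).1) (-∫ s in (0 : ℝ)..t, f (t - s) * (x s).1) t := by
  refine (hx.hasDerivAt_fst t).congr_deriv ?_
  rw [hx.snd_eq hv h0, inner_smul_right, inner_integral_smul hv _ hx.continuous_fst.continuousOn]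
  simp only [hf]
  linear_combination (∫ s in (0 : ℝ)..t, f (t - s) * (x s).1) * Complex.I_mul_I

/-- Adjoining the boson component `w` turns the memory equation back into an ordinary differential
equation with Lipschitz constant `C`, whose solution is unique. -/
lemma SolvesExchange.eq_of_solvesMemoryEquation (hv : Continuous v) {C : ℝ}
    (hC : ∀ t, ‖v t‖ ≤ C) (hf : ∀ t s, ⟪v t, v s⟫_ℂ = f (t - s))
    {x : ℝ → ℂ × H} (hx : SolvesExchange v x) (h0 : x 0 = (1, 0)) {p : ℝ → ℂ}
    (hp : SolvesMemoryEquation f p) {t : ℝ} (ht : 0 ≤ t) : p t = (x t).1 := by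
  have hpc : ContinuousOn p (Set.Icc 0 t) := fun s hs =>
    (hp.2 s hs.1).continuousWithinAt.mono Set.Icc_subset_Ici_self
  have hpv : ContinuousOn (fun r => p r • v r) (Set.Icc 0 t) := hpc.smul hv.continuousOn
  let w : ℝ → H := fun s => -Complex.I • ∫ r in (0 : ℝ)..s, p r • v r
  have hwc : ContinuousOn w (Set.Icc 0 t) := by
    have := intervalIntegral.continuousOn_primitive_interval' (a := 0)
      (ContinuousOn.intervalIntegrable_of_Icc (μ := volume) ht hpv) (Set.left_mem_uIcc)
    rw [Set.uIcc_of_le ht] at this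
    exact this.const_smul _
  have hw : ∀ s ∈ Set.Ico 0 t, HasDerivWithinAt w (-Complex.I • p s • v s) (Set.Ici s) s :=
    fun s hs => by
      have hcs : ContinuousWithinAt (fun r => p r • v r) (Set.Ioi s) s :=
        ((hp.2 s hs.1).continuousWithinAt.mono
          fun r hr => hs.1.trans (le_of_lt hr)).smul hv.continuousWithinAt
      refine HasDerivWithinAt.const_smul (-Complex.I) ?_
      -- `p` is controlled only on `[0, ∞)`, so the fundamental theorem of calculus is applied from
      -- the right, with measurability on `Ioo s t`.
      refine intervalIntegral.integral_hasDerivWithinAt_right (s := Set.Ici s) (t := Set.Ioi s)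
        ((hpv.mono (Set.Icc_subset_Icc_right hs.2.le)).intervalIntegrable_of_Icc hs.1) ?_ hcs
      refine ⟨Set.Ioo s t, Ioo_mem_nhdsGT hs.2, ?_⟩
      exact (hpv.mono fun r hr => ⟨hs.1.trans hr.1.le, hr.2.le⟩).aestronglyMeasurable
        measurableSet_Ioo
  have key := ODE_solution_unique_of_mem_Icc_right (a := 0) (b := t)
    (v := fun r y => exchangeGenerator (v r) y) (K := C.toNNReal) (s := fun _ => Set.univ)
    (f := fun s => (p s, w s)) (g := x)
    (fun r _ => ((exchangeGenerator (v r)).lipschitz.weaken (by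
      rw [← NNReal.coe_le_coe, coe_nnnorm, Real.coe_toNNReal']
      exact ((norm_exchangeGenerator_le _).trans (hC r)).trans (le_max_left _ _))).lipschitzOnWith)
    (hpc.prodMk hwc) (fun s hs => ?_) (fun _ _ => Set.mem_univ _)
    (fun s _ => (hx s).continuousAt.continuousWithinAt) (fun s _ => (hx s).hasDerivWithinAt)
    (fun _ _ => Set.mem_univ _) (by simp [w, h0, hp.1])
  · exact congrArg Prod.fst (key ⟨ht, le_rfl⟩)
  · refine HasDerivWithinAt.congr_deriv
      (((hp.2 s hs.1).mono (Set.Ici_subset_Ici.2 hs.1)).prodMk (hw s hs)) ?_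
    rw [exchangeGenerator_apply]
    congr 1
    have hpcs : ContinuousOn p (Set.uIcc 0 s) := by
      rw [Set.uIcc_of_le hs.1]; exact hpc.mono (Set.Icc_subset_Icc_right hs.2.le)
    simp only [w]
    rw [inner_smul_right, inner_integral_smul hv _ hpcs]
    simp only [hf]
    linear_combination -(∫ r in (0 : ℝ)..s, f (s - r) * p r) * Complex.I_mul_I

/-- The time-reversed solution that ends in the excited state at time `T`. -/
lemma solvesExchange_reversed (hv : Continuous v) (hf : ∀ t s, ⟪v t, v s⟫_ℂ = f (t - s))
    {q : ℝ → ℂ} (hq : ∀ t, HasDerivAt q (-∫ s in (0 : ℝ)..t, f (t - s) * q s) t) (T : ℝ) :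
    SolvesExchange v fun u =>
      (conj (q (T - u)), -Complex.I • ∫ r in T..u, conj (q (T - r)) • v r) := by
  have hqc : Continuous q := continuous_iff_continuousAt.2 fun t => (hq t).continuousAt
  have hcc : Continuous fun r => conj (q (T - r)) :=
    Complex.continuous_conj.comp (hqc.comp (continuous_const.sub continuous_id))
  intro u
  have h1 := ((hq (T - u)).comp_const_sub T u).star
  have h2 : HasDerivAt (fun u => -Complex.I • ∫ r in T..u, conj (q (T - r)) • v r)
      (-Complex.I • conj (q (T - u)) • v u) u :=
    ((hcc.smul hv).integral_hasStrictDerivAt T u).hasDerivAt.const_smul (-Complex.I)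
  refine (h1.prodMk h2).congr_deriv ?_
  rw [exchangeGenerator_apply]
  congr 1
  rw [inner_smul_right, inner_integral_smul hv _ hcc.continuousOn]
  -- Substituting `r = T - s` carries the memory integral over `[0, T - u]` to `[u, T]`; conjugation
  -- reverses the argument of `f`.
  have h4 := intervalIntegral.integral_comp_sub_left (a := 0) (b := T - u)
    (fun r => f (u - r) * conj (q (T - r))) T
  rw [sub_zero, sub_sub_cancel] at h4
  have h5 : ∀ s, conj (f (T - u - s) * q s) = f (u - (T - s)) * conj (q (T - (T - s))) :=
    fun s => by
      rw [map_mul, conj_correlation hf, sub_sub_cancel]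
      congr 2
      ring
  rw [neg_neg, Complex.star_def, conj_intervalIntegral]
  simp only [h5]
  rw [h4, intervalIntegral.integral_symm]
  simp only [hf]
  linear_combination -(∫ r in T..u, f (u - r) * conj (q (T - r))) * Complex.I_mul_I

/-- Amplitude for the excitation emitted before `t` to be reabsorbed between `t` and `t + τ`. -/
lemma SolvesExchange.fst_add_eq (hv : Continuous v) (hf : ∀ t s, ⟪v t, v s⟫_ℂ = f (t - s))
    {q : ℝ → ℂ} (hq0 : q 0 = 1)
    (hq : ∀ t, HasDerivAt q (-∫ s in (0 : ℝ)..t, f (t - s) * q s) t)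
    {x : ℝ → ℂ × H} (hx : SolvesExchange v x) {t : ℝ}
    (ht : x t = (0, -Complex.I • ∫ r in (0 : ℝ)..t, q r • v r)) (τ : ℝ) :
    (x (t + τ)).1 = -∫ r in (0 : ℝ)..t, ∫ s in (0 : ℝ)..τ, f (t + τ - r - s) * q r * q s := by
  have hqc : Continuous q := continuous_iff_continuousAt.2 fun t => (hq t).continuousAt
  have hcc : Continuous fun r => conj (q (t + τ - r)) :=
    Complex.continuous_conj.comp (hqc.comp (continuous_const.sub continuous_id))
  -- The reversed solution is `(1, 0)` at `t + τ`, so the inner product there is the wanted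
  -- amplitude. At `t` only the boson components contribute, since `(x t).1 = 0`.
  have key := hx.inner_const (solvesExchange_reversed hv hf hq (t + τ)) (t + τ) t
  simp only [sub_self, hq0, map_one, one_mul, intervalIntegral.integral_same, smul_zero,
    inner_zero_left, add_zero, ht, mul_zero, zero_add] at key
  rw [key, inner_smul_right, inner_integral_smul hv _ hqc.continuousOn,
    ← intervalIntegral.integral_const_mul, ← intervalIntegral.integral_neg]
  refine intervalIntegral.integral_congr fun r _ => ?_
  have h2 := intervalIntegral.integral_comp_sub_left (a := 0) (b := τ)
    (fun u => f (u - r) * q (t + τ - u)) (t + τ)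
  rw [sub_zero, add_sub_cancel_right] at h2
  have h3 : ∀ u, conj (⟪v r, v u⟫_ℂ * conj (q (t + τ - u))) = f (u - r) * q (t + τ - u) :=
    fun u => by rw [map_mul, Complex.conj_conj, inner_conj_symm, hf]
  have h4 : ∫ s in (0 : ℝ)..τ, f (t + τ - r - s) * q r * q s =
      q r * ∫ s in (0 : ℝ)..τ, f (t + τ - s - r) * q (t + τ - (t + τ - s)) := by
    rw [← intervalIntegral.integral_const_mul]
    refine intervalIntegral.integral_congr fun s _ => ?_
    simp only [sub_sub_cancel]
    rw [sub_right_comm]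
    ring
  rw [h4, ← inner_conj_symm, inner_smul_right, inner_integral_smul hv _ hcc.continuousOn,
    map_mul, conj_intervalIntegral]
  simp only [h3]
  rw [intervalIntegral.integral_symm, ← h2, map_neg, Complex.conj_I]
  linear_combination
    (q r * ∫ s in (0 : ℝ)..τ, f (t + τ - s - r) * q (t + τ - (t + τ - s))) * Complex.I_mul_I

end SingleExcitation

/-! ### Vacuum and product vectors -/

section Fock

variable {ι : Type*}

lemma vacuum_apply_zero : (vacuum ι : (ι →₀ ℕ) → ℂ) 0 = 1 := by
  classical
  simp [vacuum]

lemma vacuum_apply_of_ne {n : ι →₀ ℕ} (hn : n ≠ 0) : (vacuum ι : (ι →₀ ℕ) → ℂ) n = 0 := by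
  classical
  simp [vacuum, hn]

lemma norm_vacuum : ‖vacuum ι‖ = 1 := by
  classical
  rw [vacuum, lp.norm_single (by norm_num)]
  simp

lemma inner_vacuum_vacuum : ⟪vacuum ι, vacuum ι⟫_ℂ = 1 := by
  rw [inner_self_eq_norm_sq_to_K, norm_vacuum]
  simp

/-- `ketTensor s` as a continuous linear map. -/
def ketTensorL (s : Level) : FockSpace ι →L[ℂ] TotalSpace ι where
  toFun := ketTensor s
  map_add' χ χ' := by ext s' : 1; simp only [ketTensor, PiLp.add_apply]; split_ifs <;> simp
  map_smul' c χ := by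
    ext s' : 1; simp only [ketTensor, PiLp.smul_apply, RingHom.id_apply]; split_ifs <;> simp
  cont := by
    refine (PiLp.continuous_toLp 2 _).comp (continuous_pi fun s' => ?_)
    split_ifs
    · exact continuous_id
    · exact continuous_const

@[simp]
lemma ketTensorL_apply (s : Level) (χ : FockSpace ι) : ketTensorL s χ = ketTensor s χ := rfl

lemma ketTensor_apply_self (s : Level) (χ : FockSpace ι) : ketTensor s χ s = χ := by
  simp [ketTensor]

lemma ketTensor_apply_of_ne {s s' : Level} (h : s' ≠ s) (χ : FockSpace ι) :
    ketTensor s χ s' = 0 := by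
  simp [ketTensor, h]

end Fock

/-! ### Field operators on at most one boson -/

namespace SpinBoson

variable {Λ ι : Type*} [MeasurableSpace Λ] (M : SpinBoson Λ ι)

lemma orthonormal_single_single [DecidableEq (ι →₀ ℕ)] :
    Orthonormal ℂ fun i : ι => (lp.single 2 (Finsupp.single i 1) 1 : FockSpace ι) := by
  classical
  rw [orthonormal_iff_ite]
  intro i j
  rw [lp.inner_single_left, lp.single_apply]
  by_cases h : i = j
  · subst h; simp
  · have : Finsupp.single i 1 ≠ Finsupp.single j 1 := fun h' =>
      h ((Finsupp.single_left_inj one_ne_zero).1 h')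
    simp [h, this]

open Classical in
/-- The vector `b(v)† |vac⟩` with one boson in the state `v`. -/
def oneBoson : Lp ℂ 2 M.μ →ₗᵢ[ℂ] FockSpace ι :=
  (orthonormal_single_single (ι := ι)).orthogonalFamily.linearIsometry.comp
    M.basis.repr.toLinearIsometry

open Classical in
lemma hasSum_oneBoson_apply (v : Lp ℂ 2 M.μ) (n : ι →₀ ℕ) :
    HasSum (fun i => ⟪M.basis i, v⟫_ℂ * if n = Finsupp.single i 1 then 1 else 0)
      (M.oneBoson v n) := by
  have h := (orthonormal_single_single (ι := ι)).orthogonalFamily.hasSum_linearIsometry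
    (M.basis.repr v)
  have h' : HasSum _ ⟪lp.single 2 n 1, M.oneBoson v⟫_ℂ :=
    h.mapL (innerSL ℂ (lp.single 2 n 1 : FockSpace ι))
  simpa only [innerSL_apply_apply, lp.inner_single_left, LinearIsometry.toSpanSingleton_apply,
    lp.coeFn_smul, Pi.smul_apply, lp.single_apply, HilbertBasis.repr_apply_apply,
    RCLike.inner_apply, map_one, mul_one, Pi.single_apply, smul_eq_mul] using h'

lemma oneBoson_apply_single (v : Lp ℂ 2 M.μ) (i : ι) :
    M.oneBoson v (Finsupp.single i 1) = ⟪M.basis i, v⟫_ℂ := by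
  classical
  refine (M.hasSum_oneBoson_apply v _).unique ?_
  convert hasSum_ite_eq i ⟪M.basis i, v⟫_ℂ using 2 with j
  by_cases h : j = i
  · subst h; simp
  · have : Finsupp.single i 1 ≠ Finsupp.single j 1 := fun h' =>
      h ((Finsupp.single_left_inj one_ne_zero).1 h').symm
    simp [h, this]

lemma oneBoson_apply_of_ne (v : Lp ℂ 2 M.μ) {n : ι →₀ ℕ} (hn : ∀ i, n ≠ Finsupp.single i 1) :
    M.oneBoson v n = 0 := by
  classical
  refine (M.hasSum_oneBoson_apply v n).unique ?_
  simp [hn]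

/-- If the formal coefficients are those of a Fock vector, they are square-summable, so the default
value off the domain does not occur. -/
lemma annihilate_eq {v : Lp ℂ 2 M.μ} {χ φ : FockSpace ι}
    (h : ∀ n, ∑' i, ⟪v, M.basis i⟫_ℂ * ((Real.sqrt ((n i : ℝ) + 1) : ℝ) : ℂ) *
      χ (n + Finsupp.single i 1) = φ n) : M.annihilate v χ = φ := by
  have hf := funext h
  have hm : Memℓp (E := fun _ : ι →₀ ℕ => ℂ) (fun n : ι →₀ ℕ => ∑' i, ⟪v, M.basis i⟫_ℂ *
      ((Real.sqrt ((n i : ℝ) + 1) : ℝ) : ℂ) * χ (n + Finsupp.single i 1)) 2 := by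
    rw [hf]; exact lp.memℓp φ
  rw [annihilate, dif_pos hm]
  ext n
  exact h n

lemma create_eq {v : Lp ℂ 2 M.μ} {χ φ : FockSpace ι}
    (h : ∀ n : ι →₀ ℕ, ∑ i ∈ n.support, ⟪M.basis i, v⟫_ℂ * ((Real.sqrt (n i : ℝ) : ℝ) : ℂ) *
      χ (n - Finsupp.single i 1) = φ n) : M.create v χ = φ := by
  have hf := funext h
  have hm : Memℓp (E := fun _ : ι →₀ ℕ => ℂ) (fun n : ι →₀ ℕ => ∑ i ∈ n.support,
      ⟪M.basis i, v⟫_ℂ * ((Real.sqrt (n i : ℝ) : ℝ) : ℂ) * χ (n - Finsupp.single i 1)) 2 := by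
    rw [hf]; exact lp.memℓp φ
  rw [create, dif_pos hm]
  ext n
  exact h n

lemma annihilate_vacuum (v : Lp ℂ 2 M.μ) (z : ℂ) : M.annihilate v (z • vacuum ι) = 0 :=
  M.annihilate_eq fun n => by
    have h : ∀ i, n + Finsupp.single i 1 ≠ 0 := fun i h => by
      simpa using DFunLike.congr_fun h i
    simp [vacuum_apply_of_ne (h _)]

lemma create_zero (v : Lp ℂ 2 M.μ) : M.create v 0 = 0 :=
  M.create_eq fun n => by simp

lemma annihilate_oneBoson (v w : Lp ℂ 2 M.μ) :
    M.annihilate v (M.oneBoson w) = ⟪v, w⟫_ℂ • vacuum ι :=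
  M.annihilate_eq fun n => by
    rcases eq_or_ne n 0 with rfl | hn
    · simp only [zero_add, oneBoson_apply_single, Finsupp.coe_zero, Pi.zero_apply,
        Nat.cast_zero, Real.sqrt_one, Complex.ofReal_one, mul_one, lp.coeFn_smul, Pi.smul_apply,
        vacuum_apply_zero, smul_eq_mul]
      exact M.basis.tsum_inner_mul_inner v w
    · have h : ∀ i j, n + Finsupp.single i 1 ≠ Finsupp.single j 1 := fun i j h => by
        -- Total occupation numbers differ when `n ≠ 0`.
        have := congrArg Finsupp.degree h
        simp only [map_add, Finsupp.degree_single, Nat.add_eq_right] at this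
        exact hn ((Finsupp.degree_eq_zero_iff n).1 this)
      simp [M.oneBoson_apply_of_ne w (h _), vacuum_apply_of_ne hn]

lemma create_vacuum (v : Lp ℂ 2 M.μ) (z : ℂ) :
    M.create v (z • vacuum ι) = M.oneBoson (z • v) :=
  M.create_eq fun n => by
    classical
    by_cases h : ∃ j, n = Finsupp.single j 1
    · obtain ⟨j, rfl⟩ := h
      rw [Finsupp.support_single, Finset.sum_singleton, tsub_self,
        oneBoson_apply_single]
      · simp [vacuum_apply_zero, inner_smul_right, mul_comm]
      · exact one_ne_zero
    · push Not at h
      rw [M.oneBoson_apply_of_ne _ h]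
      refine Finset.sum_eq_zero fun i hi => ?_
      -- The subtraction is truncated; `i ∈ n.support` ensures that a zero difference forces `n =
      -- single i 1`.
      have hi' : n - Finsupp.single i 1 ≠ 0 := fun h' => by
        apply h i
        have hle : Finsupp.single i 1 ≤ n := by
          rw [Finsupp.single_le_iff]
          exact Nat.one_le_iff_ne_zero.2 (Finsupp.mem_support_iff.1 hi)
        exact le_antisymm (tsub_eq_zero_iff_le.1 h') hle
      simp [vacuum_apply_of_ne hi']

/-- Embedding `(z, w) ↦ z |e⟩ ⊗ |vac⟩ + |g⟩ ⊗ b(w)† |vac⟩` of the single-excitation sector. -/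
def sector : ℂ × Lp ℂ 2 M.μ →L[ℂ] TotalSpace ι :=
  (ketTensorL Level.e).comp ((ContinuousLinearMap.fst ℂ ℂ (Lp ℂ 2 M.μ)).smulRight (vacuum ι)) +
    (ketTensorL Level.g).comp (M.oneBoson.toContinuousLinearMap.comp
      (ContinuousLinearMap.snd ℂ ℂ (Lp ℂ 2 M.μ)))

lemma sector_apply (x : ℂ × Lp ℂ 2 M.μ) :
    M.sector x = ketTensor Level.e (x.1 • vacuum ι) + ketTensor Level.g (M.oneBoson x.2) := rfl

lemma sector_apply_e (x : ℂ × Lp ℂ 2 M.μ) : M.sector x Level.e = x.1 • vacuum ι := by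
  rw [sector_apply, PiLp.add_apply, ketTensor_apply_self, ketTensor_apply_of_ne (by decide),
    add_zero]

lemma sector_apply_g (x : ℂ × Lp ℂ 2 M.μ) : M.sector x Level.g = M.oneBoson x.2 := by
  rw [sector_apply, PiLp.add_apply, ketTensor_apply_self, ketTensor_apply_of_ne (by decide),
    zero_add]

/-- The sector is invariant, and the factor `iħ` cancels the prefactor in `dysonTerm`. -/
lemma hamiltonian_sector (r : ℝ) (x : ℂ × Lp ℂ 2 M.μ) :
    M.hamiltonian r (M.sector x) =
      (Complex.I * M.hbar) • M.sector (exchangeGenerator (M.modeVec r) x) := by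
  rw [hamiltonian, sector_apply_e, sector_apply_g, bathOp, bathOpAdj, annihilate_oneBoson,
    create_vacuum, sector_apply, exchangeGenerator_apply, add_comm, smul_add]
  simp only [← ketTensorL_apply, ← map_smul, smul_smul]
  have h : Complex.I * M.hbar * -Complex.I = M.hbar := by
    linear_combination -(M.hbar : ℂ) * Complex.I_mul_I
  rw [← mul_assoc, ← mul_assoc, h]

/-! ### Mode vectors, bath correlation and spectral density -/

lemma I_mul_hbar_ne_zero : Complex.I * (M.hbar : ℂ) ≠ 0 :=
  mul_ne_zero Complex.I_ne_zero (Complex.ofReal_ne_zero.2 M.hbar_pos.ne')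

lemma norm_modeVec_le (t : ℝ) : ‖M.modeVec t‖ ≤ (eLpNorm M.coupling 2 M.μ).toReal := by
  rw [modeVec, Lp.norm_toLp]
  refine le_of_eq (congrArg _ (eLpNorm_congr_norm_ae (Filter.Eventually.of_forall fun l => ?_)))
  rw [modeFun, norm_mul, mul_comm Complex.I, Complex.norm_exp_ofReal_mul_I]
  simp

lemma conj_modeFun_mul_modeFun (t s : ℝ) (l : Λ) :
    M.modeFun s l * conj (M.modeFun t l) = ((‖M.coupling l‖ ^ 2 : ℝ) : ℂ) *
      Complex.exp (Complex.I * ((M.omega0 - M.freq l) * (t - s) : ℝ)) := by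
  have h : Complex.exp (Complex.I * ((M.omega0 - M.freq l) * (t - s) : ℝ)) =
      Complex.exp (Complex.I * ((M.freq l - M.omega0) * s : ℝ)) *
        Complex.exp (conj (Complex.I * ((M.freq l - M.omega0) * t : ℝ))) := by
    rw [← Complex.exp_add, map_mul, Complex.conj_I, Complex.conj_ofReal]
    congr 1
    push_cast
    ring
  rw [h, modeFun, modeFun, map_mul, Complex.conj_conj, ← Complex.exp_conj, Complex.ofReal_pow,
    ← Complex.mul_conj']
  ring

lemma inner_modeVec (t s : ℝ) :
    ⟪M.modeVec t, M.modeVec s⟫_ℂ = ∫ l, ((‖M.coupling l‖ ^ 2 : ℝ) : ℂ) *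
      Complex.exp (Complex.I * ((M.omega0 - M.freq l) * (t - s) : ℝ)) ∂M.μ := by
  rw [L2.inner_def]
  refine integral_congr_ae ?_
  filter_upwards [(M.memLp_modeFun t).coeFn_toLp, (M.memLp_modeFun s).coeFn_toLp] with l h1 h2
  simp only [modeVec, h1, h2]
  rw [← conj_modeFun_mul_modeFun]
  rfl

lemma bathCorrelation_eq_inner (u : ℝ) :
    M.bathCorrelation u = ⟪M.modeVec u, M.modeVec 0⟫_ℂ := by
  have h : M.create (M.modeVec 0) (vacuum ι) = M.oneBoson (M.modeVec 0) := by
    simpa using M.create_vacuum (M.modeVec 0) 1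
  rw [bathCorrelation, bathOp, bathOpAdj, h, ← map_smul, annihilate_oneBoson, smul_smul,
    inner_smul_right, inner_vacuum_vacuum, inner_smul_right]
  have := Complex.ofReal_ne_zero.2 M.hbar_pos.ne'
  field_simp

lemma inner_modeVec_eq_bathCorrelation (t s : ℝ) :
    ⟪M.modeVec t, M.modeVec s⟫_ℂ = M.bathCorrelation (t - s) := by
  rw [bathCorrelation_eq_inner, inner_modeVec, inner_modeVec, sub_zero]

theorem bathCorrelation_eq_integral_spectralDensity (u : ℝ) :
    M.bathCorrelation u =
      ∫ w, Complex.exp (Complex.I * ((M.omega0 - w) * u : ℝ)) ∂M.spectralDensity := by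
  rw [bathCorrelation_eq_inner, inner_modeVec, spectralDensity,
    integral_map M.measurable_freq.aemeasurable (by
      exact (by fun_prop : Measurable fun w : ℝ =>
        Complex.exp (Complex.I * ((M.omega0 - w) * u : ℝ))).aestronglyMeasurable)]
  have hae : AEMeasurable (fun l => ‖M.coupling l‖₊ ^ 2) M.μ :=
    M.memLp_coupling.aestronglyMeasurable.aemeasurable.nnnorm.pow_const 2
  have := integral_withDensity_eq_integral_smul₀ hae
    (fun l => Complex.exp (Complex.I * ((M.omega0 - M.freq l) * u : ℝ)))
  simp only [ENNReal.coe_pow] at this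
  refine Eq.trans ?_ this.symm
  refine integral_congr_ae (Filter.Eventually.of_forall fun l => ?_)
  simp [NNReal.smul_def]

lemma continuous_bathCorrelation : Continuous M.bathCorrelation := by
  have h : M.bathCorrelation = fun u => ∫ l, ((‖M.coupling l‖ ^ 2 : ℝ) : ℂ) *
      Complex.exp (Complex.I * ((M.omega0 - M.freq l) * u : ℝ)) ∂M.μ := by
    ext u
    rw [bathCorrelation_eq_inner, inner_modeVec, sub_zero]
  rw [h]
  refine continuous_of_dominated (bound := fun l => ‖M.coupling l‖ ^ 2) (fun u => ?_)
    (fun u => Filter.Eventually.of_forall fun l => ?_) ?_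
    (Filter.Eventually.of_forall fun l => by fun_prop)
  · have h1 := M.measurable_freq
    refine AEStronglyMeasurable.mul ?_ (by fun_prop : Measurable fun l => Complex.exp
      (Complex.I * ((M.omega0 - M.freq l) * u : ℝ))).aestronglyMeasurable
    exact Complex.continuous_ofReal.comp_aestronglyMeasurable
      (M.memLp_coupling.aestronglyMeasurable.norm.pow 2)
  · rw [norm_mul, mul_comm Complex.I, Complex.norm_exp_ofReal_mul_I, mul_one, Complex.norm_real,
      Real.norm_of_nonneg (by positivity)]
  · exact M.memLp_coupling.integrable_norm_pow (by norm_num)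

/-- The squared distance is `2 Re f 0 - 2 Re f (s - t)`, so continuity of `f` suffices, even for
unbounded frequencies. -/
lemma continuous_modeVec : Continuous M.modeVec := by
  rw [continuous_iff_continuousAt]
  intro t
  rw [ContinuousAt, tendsto_iff_norm_sub_tendsto_zero]
  have h : ∀ s, ‖M.modeVec s - M.modeVec t‖ =
      Real.sqrt (2 * (M.bathCorrelation 0).re - 2 * (M.bathCorrelation (s - t)).re) := fun s => by
    rw [← Real.sqrt_sq (norm_nonneg (M.modeVec s - M.modeVec t)), @norm_sub_sq ℂ]
    have h1 : ∀ r, ‖M.modeVec r‖ ^ 2 = (M.bathCorrelation 0).re := fun r => by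
      rw [← sub_self r, ← inner_modeVec_eq_bathCorrelation]
      exact (inner_self_eq_norm_sq (𝕜 := ℂ) _).symm
    rw [h1, h1, inner_modeVec_eq_bathCorrelation]
    congr 1
    simp only [RCLike.re_to_complex]
    ring
  simp only [h]
  have hc : Continuous fun s =>
      Real.sqrt (2 * (M.bathCorrelation 0).re - 2 * (M.bathCorrelation (s - t)).re) := by
    have hs := M.continuous_bathCorrelation.comp (continuous_id.sub (continuous_const (y := t)))
    exact Real.continuous_sqrt.comp
      (continuous_const.sub (continuous_const.mul (Complex.continuous_re.comp hs)))
  simpa using hc.tendsto t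

/-! ### Evolution in the sectors and the amplitude -/

/-- The Dyson series in the single-excitation sector. -/
def sectorEvolve (s : ℝ) (x : ℂ × Lp ℂ 2 M.μ) (t : ℝ) : ℂ × Lp ℂ 2 M.μ :=
  dysonSum (fun r => exchangeGenerator (M.modeVec r)) s x t

lemma continuous_exchangeGenerator_modeVec :
    Continuous fun r => exchangeGenerator (M.modeVec r) :=
  continuous_exchangeGenerator.comp M.continuous_modeVec

lemma norm_exchangeGenerator_modeVec_le (t : ℝ) :
    ‖exchangeGenerator (M.modeVec t)‖ ≤ (eLpNorm M.coupling 2 M.μ).toReal :=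
  (norm_exchangeGenerator_le _).trans (M.norm_modeVec_le t)

lemma solvesExchange_sectorEvolve (s : ℝ) (x : ℂ × Lp ℂ 2 M.μ) :
    SolvesExchange M.modeVec (M.sectorEvolve s x) := fun t =>
  hasDerivAt_dysonSum M.continuous_exchangeGenerator_modeVec
    M.norm_exchangeGenerator_modeVec_le t

lemma dysonTerm_sector (s : ℝ) (x : ℂ × Lp ℂ 2 M.μ) (n : ℕ) (t : ℝ) :
    M.dysonTerm s (M.sector x) n t =
      M.sector (dysonIterate (fun r => exchangeGenerator (M.modeVec r)) s x n t) := by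
  induction n generalizing t with
  | zero => rfl
  | succ n ih =>
    have hc := M.continuous_exchangeGenerator_modeVec
    have hi := (hc.clm_apply (continuous_dysonIterate (s := s) (x₀ := x) hc n)).intervalIntegrable
      (μ := volume) s t
    rw [dysonTerm, dysonIterate]
    simp only [ih, hamiltonian_sector]
    rw [intervalIntegral.integral_smul, inv_smul_smul₀ M.I_mul_hbar_ne_zero]
    exact M.sector.intervalIntegral_comp_comm hi

lemma evolve_sector (t s : ℝ) (x : ℂ × Lp ℂ 2 M.μ) :
    M.evolve t s (M.sector x) = M.sector (M.sectorEvolve s x t) := by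
  rw [evolve, sectorEvolve, dysonSum,
    M.sector.map_tsum (summable_dysonIterate M.norm_exchangeGenerator_modeVec_le t)]
  simp only [dysonTerm_sector]

lemma hamiltonian_ground (r : ℝ) (z : ℂ) :
    M.hamiltonian r (ketTensor Level.g (z • vacuum ι)) = 0 := by
  rw [hamiltonian, ketTensor_apply_self, ketTensor_apply_of_ne (by decide), bathOp, bathOpAdj,
    annihilate_vacuum, create_zero, smul_zero, ← ketTensorL_apply, ← ketTensorL_apply, map_zero,
    map_zero, add_zero]

lemma hamiltonian_zero (r : ℝ) : M.hamiltonian r 0 = 0 := by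
  have h := M.hamiltonian_sector r 0
  rwa [map_zero, map_zero, map_zero, smul_zero] at h

/-- There is no excitation to exchange, so every Dyson term after the first vanishes. -/
lemma evolve_ground (t s : ℝ) (z : ℂ) :
    M.evolve t s (ketTensor Level.g (z • vacuum ι)) = ketTensor Level.g (z • vacuum ι) := by
  have h : ∀ n r, M.dysonTerm s (ketTensor Level.g (z • vacuum ι)) (n + 1) r = 0 := fun n => by
    induction n with
    | zero => intro r; simp [dysonTerm, hamiltonian_ground]
    | succ n ih => intro r; rw [dysonTerm]; simp [ih, hamiltonian_zero]
  rw [evolve, tsum_eq_single 0]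
  · rfl
  · rintro (_ | n) hn
    · exact absurd rfl hn
    · exact h n t

lemma sector_excited : M.sector (1, 0) = ketTensor Level.e (vacuum ι) := by
  rw [sector_apply, ← ketTensorL_apply Level.g, map_zero, map_zero, add_zero, one_smul]

lemma sector_ground (w : Lp ℂ 2 M.μ) : M.sector (0, w) = ketTensor Level.g (M.oneBoson w) := by
  rw [sector_apply, zero_smul, ← ketTensorL_apply Level.e, map_zero, zero_add]

/-- The solution that starts in the excited state at time `0`. -/
def excitedEvolve : ℝ → ℂ × Lp ℂ 2 M.μ := M.sectorEvolve 0 (1, 0)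

lemma excitedEvolve_zero : M.excitedEvolve 0 = (1, 0) := dysonSum_self

lemma solvesExchange_excitedEvolve : SolvesExchange M.modeVec M.excitedEvolve :=
  M.solvesExchange_sectorEvolve 0 (1, 0)

lemma state_eq (t : ℝ) : M.state t = M.sector (M.excitedEvolve t) := by
  rw [state, ← M.sector_excited, evolve_sector, excitedEvolve]

lemma amplitude_eq (t : ℝ) : M.amplitude t = (M.excitedEvolve t).1 := by
  rw [amplitude, state_eq, PiLp.inner_apply, sum_level, ketTensor_apply_self,
    ketTensor_apply_of_ne (by decide), sector_apply_e, inner_zero_left, inner_smul_right,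
    inner_vacuum_vacuum, zero_add, mul_one]

lemma hasDerivAt_amplitude (t : ℝ) :
    HasDerivAt M.amplitude (-∫ s in (0 : ℝ)..t, M.bathCorrelation (t - s) * M.amplitude s) t := by
  have h := M.solvesExchange_excitedEvolve.hasDerivAt_memory M.continuous_modeVec
    M.inner_modeVec_eq_bathCorrelation (by rw [excitedEvolve_zero]) t
  simpa only [← amplitude_eq] using h

lemma amplitude_zero : M.amplitude 0 = 1 := by rw [amplitude_eq, excitedEvolve_zero]

theorem solvesMemoryEquation_amplitude :
    SolvesMemoryEquation M.bathCorrelation M.amplitude :=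
  ⟨M.amplitude_zero, fun t _ => (M.hasDerivAt_amplitude t).hasDerivWithinAt⟩

theorem eq_amplitude_of_solvesMemoryEquation {p : ℝ → ℂ}
    (hp : SolvesMemoryEquation M.bathCorrelation p) {t : ℝ} (ht : 0 ≤ t) :
    p t = M.amplitude t := by
  rw [amplitude_eq]
  exact M.solvesExchange_excitedEvolve.eq_of_solvesMemoryEquation M.continuous_modeVec
    M.norm_modeVec_le M.inner_modeVec_eq_bathCorrelation M.excitedEvolve_zero hp ht

/-! ### The process matrix tested by the singlet -/

lemma kappa_e_g_g (t τ : ℝ) :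
    M.kappa t τ (Level.e, (Level.g, Level.g)) = M.amplitude t • vacuum ι := by
  rw [kappa, state_eq, sector_apply_e, evolve_ground, ketTensor_apply_self, amplitude_eq]

/-- Given `g` at `t`, the environment holds the emitted boson. Reinserting `g` returns to the
one-excitation sector, where reabsorption is `SolvesExchange.fst_add_eq`. -/
lemma kappa_g_g_e (t τ : ℝ) :
    M.kappa t τ (Level.g, (Level.g, Level.e)) =
      (-∫ r in (0 : ℝ)..t, ∫ s in (0 : ℝ)..τ,
        M.bathCorrelation (t + τ - r - s) * M.amplitude r * M.amplitude s) • vacuum ι := by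
  rw [kappa, state_eq, sector_apply_g, ← sector_ground, evolve_sector, sector_apply_e]
  congr 1
  refine (M.solvesExchange_sectorEvolve t _).fst_add_eq M.continuous_modeVec
    M.inner_modeVec_eq_bathCorrelation M.amplitude_zero M.hasDerivAt_amplitude ?_ τ
  rw [sectorEvolve, dysonSum_self, M.solvesExchange_excitedEvolve.snd_eq M.continuous_modeVec
    (s := 0) (by rw [excitedEvolve_zero])]
  simp only [amplitude_eq]

lemma processMatrix_apply (t τ : ℝ) (x y : Level × (Level × Level)) :
    M.processMatrix t τ x y = ⟪M.kappa t τ x, M.kappa t τ y⟫_ℂ := rfl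

/-- `Θ_*` is twice a rank-one projection and `W` is a Gram matrix up to transposition, so the trace
is a squared norm. The singlet coefficients are real, so the transposition does no harm. -/
lemma trace_singletRetriever_mul_processMatrix (t τ : ℝ) :
    (singletRetriever * M.processMatrix t τ).trace =
      ((‖M.kappa t τ (Level.g, (Level.g, Level.e)) -
        M.kappa t τ (Level.e, (Level.g, Level.g))‖ ^ 2 : ℝ) : ℂ) := by
  have h : ((‖M.kappa t τ (Level.g, (Level.g, Level.e)) -
      M.kappa t τ (Level.e, (Level.g, Level.g))‖ ^ 2 : ℝ) : ℂ) =
      ⟪M.kappa t τ (Level.g, (Level.g, Level.e)) - M.kappa t τ (Level.e, (Level.g, Level.g)),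
        M.kappa t τ (Level.g, (Level.g, Level.e)) - M.kappa t τ (Level.e, (Level.g, Level.g))⟫_ℂ := by
    rw [inner_self_eq_norm_sq_to_K]
    push_cast
    rfl
  have h2 : 2 * (((Real.sqrt 2 : ℂ))⁻¹ * ((Real.sqrt 2 : ℂ))⁻¹) = 1 := by
    simpa using two_mul_inv_sqrt_two_mul_self
  rw [h]
  simp only [Matrix.trace, Matrix.diag_apply, Matrix.mul_apply, Fintype.sum_prod_type, sum_level,
    singletRetriever_apply, singletVec, singlet, processMatrix_apply]
  simp only [if_true, if_false, reduceCtorEq, map_zero, mul_zero, zero_mul, add_zero, zero_add,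
    Complex.ofReal_inv, map_inv₀, Complex.conj_ofReal, map_neg, inner_sub_left, inner_sub_right,
    mul_neg, neg_mul, neg_neg, h2]
  ring

theorem trace_singletRetriever_mul_processMatrix_eq (t τ : ℝ) :
    (singletRetriever * M.processMatrix t τ).trace =
      ((‖M.amplitude t + ∫ r in (0 : ℝ)..t, ∫ s in (0 : ℝ)..τ,
        M.bathCorrelation (t + τ - r - s) * M.amplitude r * M.amplitude s‖ ^ 2 : ℝ) : ℂ) := by
  rw [trace_singletRetriever_mul_processMatrix, kappa_g_g_e, kappa_e_g_g, ← sub_smul, norm_smul,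
    norm_vacuum, mul_one, ← norm_neg, neg_sub, sub_neg_eq_add]

end SpinBoson

end

theorem mainTheorem5 {Λ ι : Type*} [MeasurableSpace Λ] (M : SpinBoson Λ ι) :
    IsEntanglementRetriever singletRetriever ∧
    (∀ u : ℝ, M.bathCorrelation u =
      ∫ w, Complex.exp (Complex.I * ((M.omega0 - w) * u : ℝ)) ∂M.spectralDensity) ∧
    SolvesMemoryEquation M.bathCorrelation M.amplitude ∧
    (∀ p : ℝ → ℂ, SolvesMemoryEquation M.bathCorrelation p →
      ∀ t, 0 ≤ t → p t = M.amplitude t) ∧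
    ∀ t τ : ℝ, 0 ≤ t → 0 ≤ τ →
      (singletRetriever * M.processMatrix t τ).trace =
        ((‖M.amplitude t + ∫ r in (0 : ℝ)..t, ∫ s in (0 : ℝ)..τ,
            M.bathCorrelation (t + τ - r - s) * M.amplitude r * M.amplitude s‖ ^ 2 : ℝ) : ℂ) ∧
      (1 < ((singletRetriever * M.processMatrix t τ).trace).re →
        ¬ HasClassicalMemory (M.processMatrix t τ)) := by
  exact ⟨isEntanglementRetriever_singletRetriever,
    M.bathCorrelation_eq_integral_spectralDensity,
    M.solvesMemoryEquation_amplitude,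
    fun _ hp _ ht => M.eq_amplitude_of_solvesMemoryEquation hp ht,
    fun t τ _ _ => ⟨M.trace_singletRetriever_mul_processMatrix_eq t τ, fun h hW =>
      h.not_ge (isEntanglementRetriever_singletRetriever.re_trace_mul_le_one_of_hasClassicalMemory
        hW)⟩⟩
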